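/- Let $s(n,k)$ denote the (signed) Stirling numbers of the first kind, defined by $x(x-1)\cdots(x-n+1)=\sum_{k=0}^{n}s(n,k)\,x^{k}$. A nonzero polynomial of $\mathbb{Z}[x]$ is called primitive if the greatest common divisor of its coefficients is $1$. For every integer $n\ge 0$ let $$m_n=\frac{1}{(n+1)!}\prod_{\substack{p\ \text{prime}\\ p\le n+1}}p^{\left\lfloor \frac{n}{p-1}\right\rfloor+\left\lfloor \frac{n}{p(p-1)}\right\rfloor+\left\lfloor \frac{n}{p^{2}(p-1)}\right\rfloor+\cdots}.$$ Then every $m_n$ $(n\ge 0)$ is a natural number. Moreover, for every integer $k\ge 1$ there are primitive polynomials $P_{2k},P_{2k+1}\in\mathbb{Z}[x]$ such that $$s(n,n-2k)=\frac{1}{m_{2k}}\binom{n}{2k+1}P_{2k}(n)\quad\text{for all integers } n\ge 2k,$$ $$s(n,n-2k-1)=\frac{1}{m_{2k+1}}\binom{n}{2k+2}\,n(n-1)\,P_{2k+1}(n)\quad\text{for all integers } n\ge 2k+1,$$ and $$P_{2k}(0)=P_{2k+1}(0).$$ -/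

import Mathlib

open Polynomial

/-- The (signed) Stirling number of the first kind `s(n, k)`: the coefficient of `x ^ k` in the
falling factorial `x (x - 1) ⋯ (x - n + 1)`. -/
noncomputable def stirlingS (n k : ℕ) : ℤ :=
  (descPochhammer ℤ n).coeff k

/-- The exponent `⌊n / (p - 1)⌋ + ⌊n / (p (p - 1))⌋ + ⌊n / (p² (p - 1))⌋ + ⋯` for a prime `p`
(the floors are those of natural number division). The sum stops at `i = n`, since all later
terms are zero, see `mExponent_term_eq_zero`. -/
def mExponent (n p : ℕ) : ℕ :=
  ∑ i ∈ Finset.range (n + 1), n / (p ^ i * (p - 1))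

theorem mExponent_term_eq_zero {n p i : ℕ} (hp : p.Prime) (hi : n < i) :
    n / (p ^ i * (p - 1)) = 0 := by
  have h1 : i < p ^ i := Nat.lt_pow_self hp.one_lt
  have h2 : p ^ i ≤ p ^ i * (p - 1) := Nat.le_mul_of_pos_right _ (Nat.sub_pos_of_lt hp.one_lt)
  exact Nat.div_eq_of_lt (by omega)

/-- The number `m_n = (1 / (n + 1)!) ∏_{p prime, p ≤ n + 1} p ^ (⌊n / (p - 1)⌋ + ⋯)`, as a
rational number. -/
def mSeq (n : ℕ) : ℚ :=
  1 / (Nat.factorial (n + 1) : ℚ) *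
    ∏ p ∈ (Finset.Icc 1 (n + 1)).filter Nat.Prime, (p : ℚ) ^ mExponent n p

/-! Let T_k(x) and L_k(x) be the coefficients of t^k in (t/(e^t - 1))^x and (log(1+t)/t)^x,
polynomials in x. Both encode s(n, n-k): it equals (n-1)⋯(n-k) T_k(n), and also n!/(n-k)! ·
L_k(n-k). Hence (x-k) T_k(x) = x L_k(x-k) (`X_sub_mul_powCoeff_toddSeries`).

The logarithm controls denominators. Put D_k = (k+1)! m_k. In the falling factorial basis a p-adic
estimate, attained for every prime p, shows that D_k L_k is integral and primitive
(`exists_isPrimitive_map_eq_powCoeff_logSeries`). Dividing by x and translating by k shows that D_k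
T_k(x)/x is integral and primitive; this is P_k for even k.

The Todd series gives the symmetry T(-t) = T(t) + t = e^t T(t). For odd k > 1 it yields T_k(1) = 0
and 2T_k + x T_{k-1} ≡ 0 mod x^3. Since D_k = 2D_{k-1} for such k, the factor x(x-1) splits off and
the constant terms agree (`exists_eq_X_mul_X_sub_one_mul`). -/

/-- The polynomial whose value at `m` is the coefficient of `t ^ n` in `φ ^ m`, for a power series
`φ` with constant coefficient `1`. -/
noncomputable def powCoeff (φ : PowerSeries ℚ) (n : ℕ) : ℚ[X] :=
  ∑ j ∈ Finset.range (n + 1),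
    C (PowerSeries.coeff n ((φ - 1) ^ j) / (j.factorial : ℚ)) * descPochhammer ℚ j

/-- Expand φ^m = (1 + (φ - 1))^m binomially; t divides φ - 1, so only j ≤ n contribute. -/
theorem eval_powCoeff {φ : PowerSeries ℚ} (hφ : PowerSeries.constantCoeff φ = 1) (n m : ℕ) :
    (powCoeff φ n).eval (m : ℚ) = PowerSeries.coeff n (φ ^ m) := by
  have h1 : φ ^ m = ∑ j ∈ Finset.range (m + 1), (φ - 1) ^ j * (m.choose j : PowerSeries ℚ) := by
    have := add_pow (φ - 1) 1 m
    simpa using this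
  have h2 : ∀ j, PowerSeries.coeff n ((φ - 1) ^ j * (m.choose j : PowerSeries ℚ)) =
      (m.choose j : ℚ) * PowerSeries.coeff n ((φ - 1) ^ j) := by
    intro j
    rw [mul_comm, ← nsmul_eq_mul, map_nsmul, nsmul_eq_mul]
  have h3 : PowerSeries.coeff n (φ ^ m) =
      ∑ j ∈ Finset.range (m + n + 1), (m.choose j : ℚ) * PowerSeries.coeff n ((φ - 1) ^ j) := by
    rw [h1, map_sum]
    simp only [h2]
    apply Finset.sum_subset
    · intro j
      simp only [Finset.mem_range]
      omega
    · intro j _ hj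
      rw [Nat.choose_eq_zero_of_lt (by simpa using hj)]
      simp
  rw [h3, powCoeff, eval_finsetSum]
  have h4 : ∀ j, (C (PowerSeries.coeff n ((φ - 1) ^ j) / (j.factorial : ℚ)) *
      descPochhammer ℚ j).eval (m : ℚ) = (m.choose j : ℚ) * PowerSeries.coeff n ((φ - 1) ^ j) := by
    intro j
    rw [eval_mul, eval_C, descPochhammer_eval_eq_descFactorial,
      Nat.descFactorial_eq_factorial_mul_choose]
    have : (j.factorial : ℚ) ≠ 0 := by positivity
    push_cast
    field_simp
  simp only [h4]
  apply Finset.sum_subset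
  · intro j
    simp only [Finset.mem_range]
    omega
  · intro j _ hj
    have h5 : n < j := by simpa using hj
    have h6 : (PowerSeries.X : PowerSeries ℚ) ∣ φ - 1 := by
      rw [PowerSeries.X_dvd_iff]
      simp [hφ]
    have h7 := pow_dvd_pow_of_dvd h6 j
    rw [PowerSeries.X_pow_dvd_iff] at h7
    rw [h7 n h5, mul_zero]

/-- Two rational polynomials that agree at all large natural numbers are equal. -/
theorem Polynomial.eq_of_eval_natCast_eq {P Q : ℚ[X]} (k : ℕ)
    (h : ∀ n : ℕ, k ≤ n → P.eval (n : ℚ) = Q.eval (n : ℚ)) : P = Q := by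
  apply Polynomial.eq_of_infinite_eval_eq
  apply Set.Infinite.mono (s := (fun n : ℕ => (n : ℚ)) '' Set.Ici k)
  · rintro _ ⟨n, hn, rfl⟩
    exact h n hn
  · exact (Set.Ici_infinite k).image (fun a _ b _ hab => by exact_mod_cast hab)

/-! ### Stirling numbers and powers of log(1+t) -/

theorem stirlingS_succ_succ (n m : ℕ) :
    stirlingS (n + 1) (m + 1) = stirlingS n m - n * stirlingS n (m + 1) := by
  unfold stirlingS
  rw [descPochhammer_succ_right, mul_sub, coeff_sub, coeff_mul_X, ← C_eq_natCast, coeff_mul_C]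
  simp [mul_comm]

theorem stirlingS_succ_zero (n : ℕ) : stirlingS (n + 1) 0 = 0 := by
  unfold stirlingS
  rw [coeff_zero_eq_eval_zero, descPochhammer_succ_left]
  simp

theorem stirlingS_zero (m : ℕ) : stirlingS 0 m = if m = 0 then 1 else 0 := by
  unfold stirlingS
  simp [coeff_one]

/-- The power series `log (1 + t) / t`. -/
noncomputable def logSeries : PowerSeries ℚ :=
  PowerSeries.mk fun k => (-1) ^ k / ((k : ℚ) + 1)

theorem constantCoeff_logSeries : PowerSeries.constantCoeff logSeries = 1 := by
  rw [← PowerSeries.coeff_zero_eq_constantCoeff_apply, logSeries, PowerSeries.coeff_mk]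
  simp

theorem one_add_X_mul_derivative_log :
    (1 + PowerSeries.X) * PowerSeries.derivative ℚ (PowerSeries.X * logSeries) = 1 := by
  ext n
  rw [add_mul, one_mul, map_add]
  have h : ∀ n, PowerSeries.coeff n (PowerSeries.derivative ℚ (PowerSeries.X * logSeries)) =
      (-1 : ℚ) ^ n := by
    intro n
    rw [PowerSeries.coeff_derivative, PowerSeries.coeff_succ_X_mul, logSeries,
      PowerSeries.coeff_mk]
    have : (n : ℚ) + 1 ≠ 0 := by positivity
    field_simp
  cases n with
  | zero => rw [h]; simp
  | succ n =>
    rw [PowerSeries.coeff_succ_X_mul, h, h, PowerSeries.coeff_one, if_neg (by omega)]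
    ring

theorem one_add_X_mul_derivative_log_pow (m : ℕ) :
    (1 + PowerSeries.X) *
      PowerSeries.derivative ℚ ((PowerSeries.X * logSeries) ^ (m + 1)) =
      ((m + 1 : ℕ) : PowerSeries ℚ) * (PowerSeries.X * logSeries) ^ m := by
  rw [Derivation.leibniz_pow, smul_eq_mul, nsmul_eq_mul, Nat.add_sub_cancel]
  linear_combination ((m + 1 : ℕ) : PowerSeries ℚ) * (PowerSeries.X * logSeries) ^ m *
    one_add_X_mul_derivative_log

/-- Taking coefficients in (1+t)(log^{m+1})' = (m+1) log^m reproduces the Stirling recurrence. -/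
theorem factorial_mul_coeff_log_pow (n m : ℕ) :
    (n.factorial : ℚ) * PowerSeries.coeff n ((PowerSeries.X * logSeries) ^ m) =
      m.factorial * stirlingS n m := by
  induction n generalizing m with
  | zero =>
    rw [stirlingS_zero]
    cases m with
    | zero => simp
    | succ m => simp
  | succ n ih =>
    cases m with
    | zero => simp [stirlingS_succ_zero, PowerSeries.coeff_one]
    | succ m =>
      have h := congrArg (PowerSeries.coeff n) (one_add_X_mul_derivative_log_pow m)
      have h1 : PowerSeries.coeff n (PowerSeries.X * PowerSeries.derivative ℚ
          ((PowerSeries.X * logSeries) ^ (m + 1))) =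
          (n : ℚ) * PowerSeries.coeff n ((PowerSeries.X * logSeries) ^ (m + 1)) := by
        cases n with
        | zero => simp
        | succ n =>
          rw [PowerSeries.coeff_succ_X_mul, PowerSeries.coeff_derivative]
          push_cast
          ring
      rw [add_mul, one_mul, map_add, h1, PowerSeries.coeff_derivative,
        ← nsmul_eq_mul (α := PowerSeries ℚ), map_nsmul,
        nsmul_eq_mul] at h
      rw [stirlingS_succ_succ, Nat.factorial_succ, Nat.factorial_succ]
      have i1 := ih m
      have i2 := ih (m + 1)
      rw [Nat.factorial_succ] at i2
      push_cast at *
      linear_combination (n.factorial : ℚ) * h + (m + 1) * i1 - n * i2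

theorem eval_powCoeff_logSeries (n k : ℕ) (hk : k ≤ n) :
    (n.factorial : ℚ) * (powCoeff logSeries k).eval ((n : ℚ) - k) =
      (n - k).factorial * stirlingS n (n - k) := by
  rw [← factorial_mul_coeff_log_pow, ← Nat.cast_sub hk, eval_powCoeff constantCoeff_logSeries,
    mul_pow]
  congr 1
  conv_rhs => rw [PowerSeries.coeff_X_pow_mul', if_pos (by omega)]
  congr 2
  omega

/-! ### Stirling numbers and powers of t/(e^t - 1) -/

/-- The power series `(exp t - 1) / t`. -/
noncomputable def expSeries : PowerSeries ℚ :=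
  PowerSeries.mk fun k => 1 / ((k + 1).factorial : ℚ)

theorem X_mul_expSeries : PowerSeries.X * expSeries = PowerSeries.exp ℚ - 1 := by
  ext n
  cases n with
  | zero => simp
  | succ n =>
    rw [PowerSeries.coeff_succ_X_mul, expSeries, PowerSeries.coeff_mk, map_sub,
      PowerSeries.coeff_exp, PowerSeries.coeff_one, if_neg (by omega)]
    simp

theorem constantCoeff_expSeries : PowerSeries.constantCoeff expSeries = 1 := by
  rw [← PowerSeries.coeff_zero_eq_constantCoeff_apply, expSeries, PowerSeries.coeff_mk]
  simp

/-- The power series `t / (exp t - 1)`. -/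
noncomputable def toddSeries : PowerSeries ℚ := expSeries⁻¹

theorem expSeries_mul_toddSeries : expSeries * toddSeries = 1 :=
  PowerSeries.mul_inv_cancel _ (by rw [constantCoeff_expSeries]; exact one_ne_zero)

theorem constantCoeff_toddSeries : PowerSeries.constantCoeff toddSeries = 1 := by
  rw [toddSeries, PowerSeries.constantCoeff_inv, constantCoeff_expSeries, inv_one]

theorem exp_sub_one_mul_toddSeries :
    (PowerSeries.exp ℚ - 1) * toddSeries = PowerSeries.X := by
  rw [← X_mul_expSeries, mul_assoc, expSeries_mul_toddSeries, mul_one]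

theorem exp_mul_toddSeries :
    PowerSeries.exp ℚ * toddSeries = toddSeries + PowerSeries.X := by
  linear_combination exp_sub_one_mul_toddSeries

theorem derivative_exp : PowerSeries.derivative ℚ (PowerSeries.exp ℚ) = PowerSeries.exp ℚ := by
  ext n
  rw [PowerSeries.coeff_derivative, PowerSeries.coeff_exp, PowerSeries.coeff_exp,
    Nat.factorial_succ]
  have : (n.factorial : ℚ) ≠ 0 := by positivity
  simp
  field_simp

theorem exp_sub_one_ne_zero : PowerSeries.exp ℚ - 1 ≠ 0 := by
  intro h
  have := exp_sub_one_mul_toddSeries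
  rw [h, zero_mul] at this
  exact PowerSeries.X_ne_zero this.symm

/-- Differentiating (e^t - 1)T = t gives a Riccati equation, which links T^{n+1} to T^{n+2} and so
supplies a recurrence in n. -/
theorem X_mul_derivative_toddSeries :
    PowerSeries.X * PowerSeries.derivative ℚ toddSeries =
      toddSeries - PowerSeries.X * toddSeries - toddSeries ^ 2 := by
  have h := congrArg (PowerSeries.derivative ℚ) exp_sub_one_mul_toddSeries
  have hX : PowerSeries.derivative ℚ (PowerSeries.X : PowerSeries ℚ) = 1 := by simp
  rw [Derivation.leibniz, map_sub, derivative_exp, hX] at h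
  simp only [smul_eq_mul, Derivation.map_one_eq_zero, sub_zero] at h
  apply mul_left_cancel₀ exp_sub_one_ne_zero
  linear_combination PowerSeries.X * h +
    (-1 + PowerSeries.X + toddSeries) * exp_sub_one_mul_toddSeries -
    PowerSeries.X * exp_mul_toddSeries

theorem X_mul_derivative_toddSeries_pow (n : ℕ) :
    PowerSeries.X * PowerSeries.derivative ℚ (toddSeries ^ (n + 1)) =
      ((n + 1 : ℕ) : PowerSeries ℚ) *
        (toddSeries ^ (n + 1) - PowerSeries.X * toddSeries ^ (n + 1) - toddSeries ^ (n + 2)) := by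
  rw [Derivation.leibniz_pow, smul_eq_mul, nsmul_eq_mul, Nat.add_sub_cancel]
  linear_combination ((n + 1 : ℕ) : PowerSeries ℚ) * toddSeries ^ n * X_mul_derivative_toddSeries

theorem coeff_toddSeries_pow_succ (n k : ℕ) :
    ((n : ℚ) + 1) * PowerSeries.coeff (k + 1) (toddSeries ^ (n + 2)) =
      ((n : ℚ) - k) * PowerSeries.coeff (k + 1) (toddSeries ^ (n + 1)) -
        ((n : ℚ) + 1) * PowerSeries.coeff k (toddSeries ^ (n + 1)) := by
  have h := congrArg (PowerSeries.coeff (k + 1)) (X_mul_derivative_toddSeries_pow n)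
  rw [PowerSeries.coeff_succ_X_mul, PowerSeries.coeff_derivative, ← nsmul_eq_mul, map_nsmul,
    map_sub, map_sub, PowerSeries.coeff_succ_X_mul, nsmul_eq_mul] at h
  push_cast at h
  linear_combination h

theorem stirlingS_self (n : ℕ) : stirlingS n n = 1 := by
  have h := monic_descPochhammer ℤ n
  have h2 := descPochhammer_natDegree (R := ℤ) n
  unfold stirlingS
  rw [Monic, leadingCoeff, h2] at h
  exact h

theorem descFactorial_mul_coeff_toddSeries_pow (n k : ℕ) (hk : k ≤ n + 1) :
    (n.descFactorial k : ℚ) * PowerSeries.coeff k (toddSeries ^ (n + 1)) =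
      stirlingS (n + 1) (n + 1 - k) := by
  induction n generalizing k with
  | zero =>
    interval_cases k
    · simp [stirlingS_self, constantCoeff_toddSeries]
    · simp [stirlingS_succ_zero]
  | succ n ih =>
    cases k with
    | zero => simp [stirlingS_self, constantCoeff_toddSeries]
    | succ k =>
      rcases Nat.lt_or_ge k (n + 1) with h | h
      · have e : n + 1 + 1 - (k + 1) = n - k + 1 := by omega
        have i1 := ih (k + 1) (by omega)
        have i2 := ih k (by omega)
        rw [show n + 1 - (k + 1) = n - k by omega, Nat.descFactorial_succ] at i1
        rw [show n + 1 - k = n - k + 1 by omega] at i2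
        rw [e, stirlingS_succ_succ, Nat.succ_descFactorial_succ]
        have h3 := coeff_toddSeries_pow_succ n k
        push_cast [Nat.cast_sub (show k ≤ n by omega)] at *
        linear_combination (n.descFactorial k : ℚ) * h3 + i1 - (n + 1) * i2
      -- Boundary case: the descending factorial and s(n+2, 0) both vanish.
      · have : k = n + 1 := by omega
        subst this
        simp [stirlingS_succ_zero]

theorem X_sub_mul_powCoeff_toddSeries (k : ℕ) :
    (X - C (k : ℚ)) * powCoeff toddSeries k = X * (powCoeff logSeries k).comp (X - C (k : ℚ)) := by
  apply Polynomial.eq_of_eval_natCast_eq (k + 1)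
  intro n hn
  obtain ⟨n, rfl⟩ : ∃ m, n = m + 1 := ⟨n - 1, by omega⟩
  have h1 := eval_powCoeff_logSeries (n + 1) k (by omega)
  have h2 := descFactorial_mul_coeff_toddSeries_pow n k (by omega)
  rw [← eval_powCoeff constantCoeff_toddSeries] at h2
  have h3 : (n - k).factorial * n.descFactorial k = n.factorial :=
    Nat.factorial_mul_descFactorial (by omega)
  have h4 : (n.factorial : ℚ) ≠ 0 := by positivity
  rw [← h2, show n + 1 - k = (n - k) + 1 by omega, Nat.factorial_succ, Nat.factorial_succ] at h1
  have h3' : ((n - k).factorial : ℚ) * n.descFactorial k = n.factorial := by exact_mod_cast h3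
  push_cast [Nat.cast_sub (show k ≤ n by omega)] at h1 h2 ⊢
  simp only [eval_mul, eval_sub, eval_X, eval_C, eval_comp]
  apply mul_left_cancel₀ h4
  linear_combination -h1 - ((n : ℚ) - k + 1) * (powCoeff toddSeries k).eval ((n : ℚ) + 1) * h3'

/-! ### Special values and the symmetry t ↦ -t -/

theorem X_dvd_powCoeff {φ : PowerSeries ℚ} (hφ : PowerSeries.constantCoeff φ = 1) {k : ℕ}
    (hk : k ≠ 0) : X ∣ powCoeff φ k := by
  rw [X_dvd_iff, coeff_zero_eq_eval_zero]
  have h := eval_powCoeff hφ k 0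
  rw [pow_zero, PowerSeries.coeff_one, if_neg hk] at h
  exact_mod_cast h

theorem evalNegHom_toddSeries :
    PowerSeries.evalNegHom toddSeries = toddSeries + PowerSeries.X := by
  have h1 := exp_sub_one_mul_toddSeries
  have h2 := congrArg PowerSeries.evalNegHom h1
  rw [map_mul, map_sub, map_one, PowerSeries.evalNegHom_X] at h2
  have h3 := PowerSeries.exp_mul_exp_neg_eq_one (A := ℚ)
  apply mul_left_cancel₀ exp_sub_one_ne_zero
  linear_combination -PowerSeries.exp ℚ * h2 - h1 + PowerSeries.evalNegHom toddSeries * h3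

/-- T + t/2 is even: the odd Bernoulli numbers beyond the first vanish. -/
theorem eval_one_powCoeff_toddSeries {k : ℕ} (hk : Odd k) (hk1 : k ≠ 1) :
    (powCoeff toddSeries k).eval 1 = 0 := by
  have h := eval_powCoeff constantCoeff_toddSeries k 1
  rw [Nat.cast_one, pow_one] at h
  rw [h]
  have h2 := congrArg (PowerSeries.coeff k) evalNegHom_toddSeries
  rw [PowerSeries.evalNegHom, PowerSeries.coeff_rescale, map_add, PowerSeries.coeff_X, if_neg hk1,
    hk.neg_one_pow] at h2
  linarith

/-- Coefficient of t^k in T(-t)^n = e^{nt} T(t)^n. -/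
theorem neg_one_pow_mul_powCoeff_toddSeries (k : ℕ) :
    (-1) ^ k * powCoeff toddSeries k =
      ∑ j ∈ Finset.range (k + 1),
        powCoeff toddSeries (k - j) * X ^ j * C (1 / (j.factorial : ℚ)) := by
  apply Polynomial.eq_of_eval_natCast_eq 0
  intro n _
  have h : PowerSeries.evalNegHom (toddSeries ^ n) =
      PowerSeries.exp ℚ ^ n * toddSeries ^ n := by
    rw [map_pow, evalNegHom_toddSeries, ← exp_mul_toddSeries, mul_pow]
  have h2 := congrArg (PowerSeries.coeff k) h
  rw [PowerSeries.evalNegHom, PowerSeries.coeff_rescale, PowerSeries.exp_pow_eq_rescale_exp,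
    PowerSeries.coeff_mul, Finset.Nat.sum_antidiagonal_eq_sum_range_succ_mk] at h2
  rw [eval_mul, eval_pow, eval_neg, eval_one, eval_powCoeff constantCoeff_toddSeries, h2,
    eval_finsetSum]
  refine Finset.sum_congr rfl fun j _ => ?_
  simp only [eval_mul, eval_pow, eval_X, eval_C, eval_powCoeff constantCoeff_toddSeries,
    PowerSeries.coeff_rescale, PowerSeries.coeff_exp]
  simp
  ring

theorem X_pow_three_dvd_powCoeff_toddSeries (l : ℕ) (hl : 1 ≤ l) :
    (X : ℚ[X]) ^ 3 ∣ 2 * powCoeff toddSeries (2 * l + 1) + X * powCoeff toddSeries (2 * l) := by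
  have h := neg_one_pow_mul_powCoeff_toddSeries (2 * l + 1)
  rw [Odd.neg_one_pow ⟨l, rfl⟩, Finset.sum_range_succ',
    Finset.sum_range_succ'] at h
  have h2 : 2 * powCoeff toddSeries (2 * l + 1) + X * powCoeff toddSeries (2 * l) =
      -∑ j ∈ Finset.range (2 * l), powCoeff toddSeries (2 * l + 1 - (j + 1 + 1)) * X ^ (j + 1 + 1) *
        C (1 / ((j + 1 + 1).factorial : ℚ)) := by
    simp at h ⊢
    linear_combination -h
  rw [h2, dvd_neg]
  -- The original index is j + 2. The quadratic term gets its third factor X from T_{2l-1}, as 2l -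
  -- 1 ≠ 0.
  refine Finset.dvd_sum fun j hj => Dvd.dvd.mul_right ?_ _
  cases j with
  | zero =>
    rw [show (3 : ℕ) = 1 + 2 by rfl, pow_add, pow_one]
    exact mul_dvd_mul (X_dvd_powCoeff constantCoeff_toddSeries (by omega)) (by simp)
  | succ j => exact Dvd.dvd.mul_left (pow_dvd_pow _ (by omega)) _

/-! ### p-integrality and growth of denominators -/

/-- The ring of rational numbers whose denominator is prime to `p`. -/
def pIntegral (p : ℕ) (hp : p.Prime) : Subring ℚ where
  carrier := {q | ¬ p ∣ q.den}
  mul_mem' {a b} ha hb h := by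
    rcases (hp.dvd_mul).1 (h.trans (Rat.mul_den_dvd a b)) with h | h
    exacts [ha h, hb h]
  one_mem' := by
    simpa using hp.one_lt.ne'
  add_mem' {a b} ha hb h := by
    rcases (hp.dvd_mul).1 (h.trans (Rat.add_den_dvd a b)) with h | h
    exacts [ha h, hb h]
  zero_mem' := by
    simpa using hp.one_lt.ne'
  neg_mem' {a} ha := by simpa using ha

theorem mem_pIntegral {p : ℕ} {hp : p.Prime} {q : ℚ} : q ∈ pIntegral p hp ↔ ¬ p ∣ q.den := Iff.rfl

theorem one_div_natCast_mem_pIntegral {p : ℕ} (hp : p.Prime) {m : ℕ} (hm : ¬ p ∣ m) :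
    1 / (m : ℚ) ∈ pIntegral p hp := by
  rw [mem_pIntegral]
  intro h
  apply hm
  have h1 := Rat.den_dvd 1 (m : ℤ)
  rw [Rat.divInt_eq_div, Int.cast_one, Int.cast_natCast, Int.natCast_dvd_natCast] at h1
  exact h.trans h1

theorem pow_div_natCast_mem_pIntegral {p : ℕ} (hp : p.Prime) {m e : ℕ} (hm : m ≠ 0)
    (h : padicValNat p m ≤ e) : (p : ℚ) ^ e / m ∈ pIntegral p hp := by
  have := Fact.mk hp
  obtain ⟨b, hb⟩ : p ^ padicValNat p m ∣ m := pow_padicValNat_dvd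
  have hpb : ¬ p ∣ b := by
    rintro ⟨c, rfl⟩
    apply pow_succ_padicValNat_not_dvd (p := p) hm
    exact ⟨c, by rw [pow_succ, mul_assoc, ← hb]⟩
  obtain ⟨f, rfl⟩ := Nat.exists_eq_add_of_le h
  have hb0 : (b : ℚ) ≠ 0 := by
    rintro h0
    apply hpb
    rw [Nat.cast_eq_zero] at h0
    simp [h0]
  have hp0 : (p : ℚ) ≠ 0 := by exact_mod_cast hp.ne_zero
  have : (p : ℚ) ^ (padicValNat p m + f) / m = p ^ f * (1 / (b : ℚ)) := by
    conv_lhs => rw [show (m : ℚ) = p ^ padicValNat p m * b by exact_mod_cast hb]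
    rw [pow_add]
    field_simp
  rw [this]
  exact mul_mem (pow_mem (natCast_mem _ _) _) (one_div_natCast_mem_pIntegral hp hpb)

theorem one_div_prime_notMem_pIntegral {p : ℕ} (hp : p.Prime) :
    1 / (p : ℚ) ∉ pIntegral p hp := by
  rw [mem_pIntegral, not_not]
  simp [hp.ne_zero]

theorem exists_intCast_eq_of_forall_mem_pIntegral {q : ℚ}
    (h : ∀ (p : ℕ) (hp : p.Prime), q ∈ pIntegral p hp) : ∃ z : ℤ, (z : ℚ) = q := by
  refine ⟨q.num, ?_⟩
  rw [Rat.coe_int_num_of_den_eq_one]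
  by_contra hd
  obtain ⟨p, hp, hpd⟩ := Nat.exists_prime_and_dvd hd
  exact h p hp hpd

/-- Power series whose `i`-th coefficient has denominator dividing `p ^ ⌊i / d⌋` up to a factor
prime to `p`. -/
def growthSubmonoid (p : ℕ) (hp : p.Prime) (d : ℕ) : Submonoid (PowerSeries ℚ) where
  carrier := {φ | ∀ i, (p : ℚ) ^ (i / d) * PowerSeries.coeff i φ ∈ pIntegral p hp}
  one_mem' i := by
    rw [PowerSeries.coeff_one]
    split_ifs
    · rw [mul_one]
      exact pow_mem (natCast_mem _ _) _
    · rw [mul_zero]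
      exact zero_mem _
  mul_mem' {φ ψ} hφ hψ i := by
    rw [PowerSeries.coeff_mul, Finset.mul_sum]
    refine sum_mem fun x hx => ?_
    have hx' : x.1 + x.2 = i := by simpa using hx
    have h1 : x.1 / d + x.2 / d ≤ i / d := by
      rw [← hx']
      exact Nat.div_add_div_le_add_div
    obtain ⟨f, hf⟩ := Nat.exists_eq_add_of_le h1
    have : (p : ℚ) ^ (i / d) * (PowerSeries.coeff x.1 φ * PowerSeries.coeff x.2 ψ) =
        p ^ f * ((p ^ (x.1 / d) * PowerSeries.coeff x.1 φ) *
          (p ^ (x.2 / d) * PowerSeries.coeff x.2 ψ)) := by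
      rw [hf]
      ring
    rw [this]
    exact mul_mem (pow_mem (natCast_mem _ _) _) (mul_mem (hφ _) (hψ _))

theorem mem_growthSubmonoid {p : ℕ} {hp : p.Prime} {d : ℕ} {φ : PowerSeries ℚ} :
    φ ∈ growthSubmonoid p hp d ↔
      ∀ i, (p : ℚ) ^ (i / d) * PowerSeries.coeff i φ ∈ pIntegral p hp := Iff.rfl

/-- If the valuation is v + 1, then q ≥ p(p^v - 1), and Bernoulli's inequality gives p^v - 1 ≥
v(p-1). -/
theorem padicValNat_add_le {p : ℕ} (hp : p.Prime) (q : ℕ) :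
    padicValNat p (q + p) ≤ 1 + q / (p * (p - 1)) := by
  have := Fact.mk hp
  rcases Nat.eq_zero_or_pos (padicValNat p (q + p)) with h0 | h0
  · rw [h0]
    exact Nat.zero_le _
  obtain ⟨v, hv⟩ : ∃ v, padicValNat p (q + p) = v + 1 := ⟨_, (Nat.succ_pred_eq_of_pos h0).symm⟩
  have h1 : p ^ (v + 1) ≤ q + p := by
    rw [← hv]
    exact Nat.le_of_dvd (by have := hp.pos; omega) pow_padicValNat_dvd
  rw [hv, add_comm 1, Nat.add_le_add_iff_right,
    Nat.le_div_iff_mul_le (Nat.mul_pos hp.pos (Nat.sub_pos_of_lt hp.one_lt))]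
  obtain ⟨s, rfl⟩ : ∃ s, p = s + 1 := ⟨p - 1, by have := hp.pos; omega⟩
  rw [Nat.add_sub_cancel]
  have h2 : 1 + v * s ≤ (s + 1) ^ v := by
    have := one_add_mul_le_pow (R := ℤ) (a := s) (by omega) v
    rw [add_comm (s : ℕ) 1]
    exact_mod_cast this
  rw [pow_succ] at h1
  nlinarith

/-! ### Exact p-adic denominators for the logarithm -/

/-- The terms of `log (1 + t) / t` whose coefficient is not `p`-integral, divided by
`t ^ (p - 1)`. -/
noncomputable def logSeriesSingular (p : ℕ) : PowerSeries ℚ :=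
  PowerSeries.mk fun q => if p ∣ q then (-1) ^ (q + p - 1) / ((q : ℚ) + p) else 0

/-- The terms of `log (1 + t) / t - 1` whose coefficient is `p`-integral, divided by `t`. -/
noncomputable def logSeriesRegular (p : ℕ) : PowerSeries ℚ :=
  PowerSeries.mk fun i => if p ∣ i + 2 then 0 else (-1) ^ (i + 1) / ((i : ℚ) + 2)

theorem logSeries_sub_one {p : ℕ} (hp : p.Prime) :
    logSeries - 1 = PowerSeries.X ^ (p - 1) * logSeriesSingular p +
      PowerSeries.X * logSeriesRegular p := by
  have hp2 := hp.two_le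
  ext k
  rw [map_sub, map_add, PowerSeries.coeff_X_pow_mul']
  cases k with
  | zero =>
    rw [if_neg (by omega)]
    simp [constantCoeff_logSeries]
  | succ i =>
    rw [PowerSeries.coeff_succ_X_mul, logSeries, logSeriesSingular, logSeriesRegular,
      PowerSeries.coeff_mk, PowerSeries.coeff_mk, PowerSeries.coeff_mk, PowerSeries.coeff_one,
      if_neg (by omega)]
    by_cases h : p ∣ i + 2
    · have h1 : p ≤ i + 2 := Nat.le_of_dvd (by omega) h
      have h2 : p ∣ i + 1 - (p - 1) := by
        rw [show i + 1 - (p - 1) = i + 2 - p by omega]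
        exact Nat.dvd_sub h dvd_rfl
      rw [if_pos h, if_pos (by omega), if_pos h2, show i + 1 - (p - 1) + p - 1 = i + 1 by omega]
      have h3 : ((i + 1 - (p - 1) : ℕ) : ℚ) + p = ((i + 1 : ℕ) : ℚ) + 1 := by
        rw [← Nat.cast_add, show i + 1 - (p - 1) + p = i + 1 + 1 by omega]
        push_cast
        ring
      rw [h3]
      ring
    · rw [if_neg h]
      have h2 : (if p - 1 ≤ i + 1 then if p ∣ i + 1 - (p - 1) then
          (-1 : ℚ) ^ (i + 1 - (p - 1) + p - 1) / (((i + 1 - (p - 1) : ℕ) : ℚ) + p) else 0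
          else 0) = 0 := by
        split_ifs with h3 h4
        · exfalso
          apply h
          have := Nat.dvd_add h4 dvd_rfl
          rwa [show i + 1 - (p - 1) + p = i + 2 by omega] at this
        · rfl
        · rfl
      rw [h2]
      push_cast
      ring

theorem neg_one_pow_mem (S : Subring ℚ) (k : ℕ) : (-1 : ℚ) ^ k ∈ S :=
  pow_mem (neg_mem (one_mem _)) _

theorem logSeriesSingular_mem {p : ℕ} (hp : p.Prime) :
    PowerSeries.C (p : ℚ) * logSeriesSingular p ∈ growthSubmonoid p hp (p * (p - 1)) := by
  rw [mem_growthSubmonoid]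
  intro i
  rw [PowerSeries.coeff_C_mul, logSeriesSingular, PowerSeries.coeff_mk]
  split_ifs with h
  · have h1 := pow_div_natCast_mem_pIntegral hp (m := i + p) (by have := hp.pos; omega)
      (padicValNat_add_le hp i)
    have : (p : ℚ) ^ (i / (p * (p - 1))) * (p * ((-1) ^ (i + p - 1) / ((i : ℚ) + p))) =
        (-1) ^ (i + p - 1) * (p ^ (1 + i / (p * (p - 1))) / ((i + p : ℕ) : ℚ)) := by
      push_cast
      ring
    rw [this]
    exact mul_mem (neg_one_pow_mem _ _) h1
  · rw [mul_zero, mul_zero]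
    exact zero_mem _

theorem logSeriesRegular_mem {p : ℕ} (hp : p.Prime) (d : ℕ) :
    logSeriesRegular p ∈ growthSubmonoid p hp d := by
  rw [mem_growthSubmonoid]
  intro i
  refine mul_mem (pow_mem (natCast_mem _ _) _) ?_
  rw [logSeriesRegular, PowerSeries.coeff_mk]
  split_ifs with h
  · exact zero_mem _
  · have : (-1 : ℚ) ^ (i + 1) / ((i : ℚ) + 2) = (-1) ^ (i + 1) * (1 / ((i + 2 : ℕ) : ℚ)) := by
      push_cast
      ring
    rw [this]
    exact mul_mem (neg_one_pow_mem _ _) (one_div_natCast_mem_pIntegral hp h)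

/-- The contribution to the coefficient of `t ^ n` in `(log (1 + t) / t - 1) ^ (c + d) / (c + d)!`
of the products of `c` singular and `d` regular terms. -/
noncomputable def mixedCoeff (p n c d : ℕ) : ℚ :=
  PowerSeries.coeff n ((PowerSeries.X ^ (p - 1) * logSeriesSingular p) ^ c *
    (PowerSeries.X * logSeriesRegular p) ^ d) / ((c.factorial : ℚ) * d.factorial)

theorem coeff_logSeries_sub_one_pow {p : ℕ} (hp : p.Prime) (n j : ℕ) :
    PowerSeries.coeff n ((logSeries - 1) ^ j) / (j.factorial : ℚ) =
      ∑ x ∈ Finset.HasAntidiagonal.antidiagonal j, mixedCoeff p n x.1 x.2 := by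
  rw [logSeries_sub_one hp, (Commute.all _ _).add_pow', map_sum, Finset.sum_div]
  refine Finset.sum_congr rfl fun x hx => ?_
  have hx' : x.1 + x.2 = j := by simpa using hx
  have h : j.choose x.1 * x.1.factorial * x.2.factorial = j.factorial := by
    have := Nat.choose_mul_factorial_mul_factorial (n := j) (k := x.1) (by omega)
    rwa [show j - x.1 = x.2 by omega] at this
  have h' : (j.choose x.1 : ℚ) * x.1.factorial * x.2.factorial = j.factorial := by
    exact_mod_cast h
  rw [map_nsmul, nsmul_eq_mul, mixedCoeff, ← h']
  have h1 : (j.choose x.1 : ℚ) ≠ 0 := by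
    exact_mod_cast (Nat.choose_pos (by omega)).ne'
  have h2 : (x.1.factorial : ℚ) ≠ 0 := by positivity
  have h3 : (x.2.factorial : ℚ) ≠ 0 := by positivity
  field_simp

theorem mixedCoeff_eq (p n c d : ℕ) :
    mixedCoeff p n c d = (if c * (p - 1) + d ≤ n then
      PowerSeries.coeff (n - (c * (p - 1) + d)) (logSeriesSingular p ^ c * logSeriesRegular p ^ d)
      else 0) / ((c.factorial : ℚ) * d.factorial) := by
  have : (PowerSeries.X ^ (p - 1) * logSeriesSingular p) ^ c *
      (PowerSeries.X * logSeriesRegular p) ^ d =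
      PowerSeries.X ^ (c * (p - 1) + d) *
        (logSeriesSingular p ^ c * logSeriesRegular p ^ d) := by
    rw [mul_pow, mul_pow, ← pow_mul, pow_add, mul_comm (p - 1)]
    ring
  rw [mixedCoeff, this, PowerSeries.coeff_X_pow_mul']

/-- The four costs: one p per singular factor, the growth of the remaining coefficient, and the two
factorials. -/
theorem pow_mul_mixedCoeff_mem {p : ℕ} (hp : p.Prime) {n c d E : ℕ}
    (h : c * (p - 1) + d ≤ n → c + (n - (c * (p - 1) + d)) / (p * (p - 1)) +
      padicValNat p d.factorial + padicValNat p c.factorial ≤ E) :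
    (p : ℚ) ^ E * mixedCoeff p n c d ∈ pIntegral p hp := by
  have := Fact.mk hp
  rw [mixedCoeff_eq]
  split_ifs with hn
  · obtain ⟨f, hf⟩ := Nat.exists_eq_add_of_le (h hn)
    set q := n - (c * (p - 1) + d) with hq
    have h1 := mul_mem (pow_mem (logSeriesSingular_mem hp) c)
      (pow_mem (logSeriesRegular_mem hp (p * (p - 1))) d)
    rw [mul_pow, ← map_pow, mul_assoc, mem_growthSubmonoid] at h1
    have h2 := h1 q
    rw [PowerSeries.coeff_C_mul] at h2
    have h3 := pow_div_natCast_mem_pIntegral hp (Nat.factorial_ne_zero c) le_rfl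
    have h4 := pow_div_natCast_mem_pIntegral hp (Nat.factorial_ne_zero d) le_rfl
    have h5 := mul_mem (mul_mem h2 (mul_mem h3 h4)) (pow_mem (natCast_mem (pIntegral p hp) p) f)
    convert h5 using 1
    rw [hf]
    ring
  · rw [zero_div, mul_zero]
    exact zero_mem _

theorem padicValNat_factorial_mono (p : ℕ) [Fact p.Prime] {a b : ℕ} (h : a ≤ b) :
    padicValNat p a.factorial ≤ padicValNat p b.factorial :=
  (padicValNat_dvd_iff_le (Nat.factorial_ne_zero b)).1
    (pow_padicValNat_dvd.trans (Nat.factorial_dvd_factorial h))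

/-- The exponent of `p` in the common denominator. -/
theorem pow_mul_coeff_logSeries_sub_one_pow_mem {p : ℕ} (hp : p.Prime) (n j : ℕ) :
    (p : ℚ) ^ (n / (p - 1) + padicValNat p (n / (p - 1)).factorial) *
      (PowerSeries.coeff n ((logSeries - 1) ^ j) / (j.factorial : ℚ)) ∈ pIntegral p hp := by
  have := Fact.mk hp
  rw [coeff_logSeries_sub_one_pow hp, Finset.mul_sum]
  refine sum_mem fun x _ => pow_mul_mixedCoeff_mem hp fun hn => ?_
  obtain ⟨c, d⟩ := x
  dsimp only at hn ⊢
  obtain ⟨s, rfl⟩ : ∃ s, p = s + 1 := ⟨p - 1, by have := hp.pos; omega⟩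
  have hs : 0 < s := by have := hp.two_le; omega
  rw [Nat.add_sub_cancel] at *
  have h1 : c ≤ n / s := by
    rw [Nat.le_div_iff_mul_le hs]
    omega
  refine add_le_add ?_ (padicValNat_factorial_mono _ h1)
  rw [Nat.le_div_iff_mul_le hs]
  -- Legendre's formula: d regular factors, of total degree at least d, pay for the valuation of d!.
  have h2 : s * padicValNat (s + 1) d.factorial ≤ d := by
    have := sub_one_mul_padicValNat_factorial (p := s + 1) d
    rw [Nat.add_sub_cancel] at this
    omega
  have h3 := Nat.div_mul_le_self (n - (c * s + d)) ((s + 1) * s)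
  set W := (n - (c * s + d)) / ((s + 1) * s)
  have h4 : W * s ≤ W * ((s + 1) * s) := by
    rw [← mul_assoc]
    exact Nat.mul_le_mul_right _ (Nat.le_mul_of_pos_right _ (by omega))
  have h5 : (c + W + padicValNat (s + 1) d.factorial) * s =
      c * s + W * s + s * padicValNat (s + 1) d.factorial := by ring
  omega

/-- Here s = p - 1, n = sN + r and V is the valuation of d!. For c < N, trading singular factors for
regular ones loses more powers of p than W and V recover; for c > N the degree would exceed n. -/
theorem singular_exponent_lt {s N r c d W V : ℕ} (hs : 0 < s) (hr : r < s)
    (hcd : c + d = N + r) (hn : c * s + d ≤ s * N + r) (hc : c ≠ N)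
    (hW : W * ((s + 1) * s) ≤ s * N + r - (c * s + d)) (hV : d ≠ 0 → s * V < d) :
    c + W + V + 1 ≤ N := by
  rcases Nat.lt_or_gt_of_ne hc with h | h
  · obtain ⟨e, rfl⟩ := Nat.exists_eq_add_of_lt h
    obtain rfl : d = r + e + 1 := by omega
    have hV' := hV (by omega)
    by_contra hcon
    have h1 : e + 1 ≤ W + V := by omega
    zify [hn] at *
    have h2 : ((e : ℤ) + 1) * ((s + 1) * s) ≤ (W + V) * ((s + 1) * s) :=
      mul_le_mul_of_nonneg_right h1 (by positivity)
    have h3 : (s : ℤ) * V * (s + 1) ≤ (r + e) * (s + 1) :=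
      mul_le_mul_of_nonneg_right (by omega) (by positivity)
    have h4 : (r : ℤ) * (s + 1) ≤ (s - 1) * (s + 1) :=
      mul_le_mul_of_nonneg_right (by omega) (by positivity)
    have h5 : (0 : ℤ) ≤ e * (s * (s - 1)) :=
      mul_nonneg (by positivity) (mul_nonneg (by positivity) (by omega))
    nlinarith
  · exfalso
    obtain ⟨e, rfl⟩ := Nat.exists_eq_add_of_lt h
    obtain rfl : r = d + e + 1 := by omega
    obtain ⟨u, rfl⟩ : ∃ u, s = u + 2 := ⟨s - 2, by omega⟩
    nlinarith [Nat.zero_le (e * u)]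

/-- The factors already have total lowest degree n, so only their constant terms ±1/p and -1/2
enter. -/
theorem mixedCoeff_main {p : ℕ} (hp : p.Prime) (n : ℕ) :
    (p : ℚ) ^ (n / (p - 1) + padicValNat p (n / (p - 1)).factorial) *
      mixedCoeff p n (n / (p - 1)) (n % (p - 1)) / p ∉ pIntegral p hp := by
  intro hmem
  have hp0 : (p : ℚ) ≠ 0 := by exact_mod_cast hp.ne_zero
  have hn : n / (p - 1) * (p - 1) + n % (p - 1) = n := by
    rw [mul_comm]
    exact Nat.div_add_mod _ _
  have hs : 0 < p - 1 := Nat.sub_pos_of_lt hp.one_lt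
  have hr : n % (p - 1) < p - 1 := Nat.mod_lt _ hs
  rw [mixedCoeff_eq, if_pos hn.le, hn, Nat.sub_self] at hmem
  generalize n / (p - 1) = N at *
  generalize n % (p - 1) = r at *
  have h1 : PowerSeries.constantCoeff (logSeriesSingular p) = (-1) ^ (p - 1) / p := by
    rw [← PowerSeries.coeff_zero_eq_constantCoeff_apply, logSeriesSingular, PowerSeries.coeff_mk]
    simp
  have h2 : PowerSeries.constantCoeff (logSeriesRegular p) ^ r = (-1 / 2) ^ r := by
    rcases Nat.eq_zero_or_pos r with h0 | h0
    · rw [h0, pow_zero, pow_zero]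
    · rw [← PowerSeries.coeff_zero_eq_constantCoeff_apply, logSeriesRegular, PowerSeries.coeff_mk,
        if_neg]
      · norm_num
      · intro h
        have := Nat.le_of_dvd (by omega) h
        omega
  rw [PowerSeries.coeff_zero_eq_constantCoeff_apply, map_mul, map_pow, map_pow, h1, h2] at hmem
  obtain ⟨b, hb⟩ : p ^ padicValNat p N.factorial ∣ N.factorial := pow_padicValNat_dvd
  have hb' : (N.factorial : ℚ) = p ^ padicValNat p N.factorial * b := by exact_mod_cast hb
  have hb0 : (b : ℚ) ≠ 0 := by
    intro h
    rw [h, mul_zero] at hb'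
    exact Nat.factorial_ne_zero N (by exact_mod_cast hb')
  -- This integer multiplier turns the coefficient into exactly 1/p; it need not be prime to p.
  have h3 := mul_mem (mul_mem (natCast_mem (pIntegral p hp) (b * 2 ^ r * r.factorial)) hmem)
    (neg_one_pow_mem (pIntegral p hp) ((p - 1) * N + r))
  apply one_div_prime_notMem_pIntegral hp
  convert h3 using 1
  have hr0 : (r.factorial : ℚ) ≠ 0 := by positivity
  have e1 : ((-1 : ℚ) ^ ((p - 1) * N + r)) * (-1) ^ ((p - 1) * N + r) = 1 := by
    rw [← mul_pow]
    simp
  rw [hb', div_pow, div_pow, ← pow_mul, pow_add]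
  push_cast
  field_simp
  rw [pow_add] at e1
  linear_combination -e1

/-- Sharpness at j = N + r: every splitting other than (N, r) has a spare factor p, so nothing
cancels the main term. -/
theorem pow_mul_coeff_logSeries_sub_one_pow_div_notMem {p : ℕ} (hp : p.Prime) (n : ℕ) :
    (p : ℚ) ^ (n / (p - 1) + padicValNat p (n / (p - 1)).factorial) *
      (PowerSeries.coeff n ((logSeries - 1) ^ (n / (p - 1) + n % (p - 1))) /
        ((n / (p - 1) + n % (p - 1)).factorial : ℚ)) / p ∉ pIntegral p hp := by
  have := Fact.mk hp
  have hp0 : (p : ℚ) ≠ 0 := by exact_mod_cast hp.ne_zero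
  intro hmem
  apply mixedCoeff_main hp n
  rw [coeff_logSeries_sub_one_pow hp,
    ← Finset.add_sum_erase _ _ (a := (n / (p - 1), n % (p - 1))) (by simp), mul_add, add_div] at hmem
  refine (add_mem_cancel_right ?_).1 hmem
  rw [Finset.mul_sum, Finset.sum_div]
  refine sum_mem fun x hx => ?_
  obtain ⟨c, d⟩ := x
  rw [Finset.mem_erase, Finset.HasAntidiagonal.mem_antidiagonal] at hx
  obtain ⟨hne, hcd⟩ := hx
  dsimp only at hcd ⊢
  have hc : c ≠ n / (p - 1) := by
    rintro rfl
    exact hne (by rw [Nat.add_left_cancel hcd])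
  have hs : 0 < p - 1 := Nat.sub_pos_of_lt hp.one_lt
  have hr : n % (p - 1) < p - 1 := Nat.mod_lt _ hs
  have hdm : (p - 1) * (n / (p - 1)) + n % (p - 1) = n := Nat.div_add_mod _ _
  have key : c * (p - 1) + d ≤ n → c + (n - (c * (p - 1) + d)) / (p * (p - 1)) +
      padicValNat p d.factorial + 1 ≤ n / (p - 1) := by
    intro hn
    refine singular_exponent_lt hs hr hcd (by rwa [hdm]) hc ?_ ?_
    · rw [hdm, Nat.sub_add_cancel hp.one_le]
      exact Nat.div_mul_le_self _ _
    · exact sub_one_mul_padicValNat_factorial_lt_of_ne_zero p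
  by_cases hn : c * (p - 1) + d ≤ n
  · have hk := key hn
    clear key hdm hr hcd hc hne hmem
    generalize n / (p - 1) = N at hk ⊢
    have hW := Nat.zero_le ((n - (c * (p - 1) + d)) / (p * (p - 1)))
    obtain ⟨E, hE⟩ : ∃ E, N + padicValNat p (N).factorial = E + 1 :=
      ⟨N + padicValNat p (N).factorial - 1, by omega⟩
    have h1 : (p : ℚ) ^ E * mixedCoeff p n c d ∈ pIntegral p hp := by
      refine pow_mul_mixedCoeff_mem hp fun _ => ?_
      have := padicValNat_factorial_mono p (show c ≤ N by omega)
      omega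
    convert h1 using 1
    rw [hE, pow_succ]
    field_simp
  · rw [mixedCoeff_eq, if_neg hn]
    simp

/-! ### The common denominator -/

theorem mExponent_eq {p : ℕ} (hp : p.Prime) (n : ℕ) :
    mExponent n p = n / (p - 1) + padicValNat p (n / (p - 1)).factorial := by
  have := Fact.mk hp
  have hlog : Nat.log p (n / (p - 1)) < n + 1 :=
    Nat.lt_succ_of_le ((Nat.log_le_self _ _).trans (Nat.div_le_self _ _))
  rw [padicValNat_factorial hlog, Finset.sum_Ico_eq_sum_range, mExponent, Finset.sum_range_succ',
    pow_zero, one_mul, add_comm, Nat.add_sub_cancel]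
  congr 1
  refine Finset.sum_congr rfl fun i _ => ?_
  rw [Nat.div_div_eq_div_mul, mul_comm (p - 1), add_comm 1]

/-- The least common denominator of the coefficients of `powCoeff logSeries n`. -/
def commonDenom (n : ℕ) : ℕ :=
  ∏ p ∈ (Finset.Icc 1 (n + 1)).filter Nat.Prime, p ^ mExponent n p

theorem mSeq_eq (n : ℕ) : mSeq n = commonDenom n / (n + 1).factorial := by
  rw [mSeq, commonDenom]
  push_cast
  ring

theorem commonDenom_pos (n : ℕ) : 0 < commonDenom n :=
  Finset.prod_pos fun _ hp => pow_pos (Finset.mem_filter.1 hp).2.pos _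

theorem exists_commonDenom_eq {p : ℕ} (hp : p.Prime) (n : ℕ) :
    ∃ u, ¬ p ∣ u ∧ commonDenom n = p ^ mExponent n p * u := by
  have key : ∀ s : Finset ℕ, (∀ q ∈ s, q.Prime ∧ q ≠ p) → ¬ p ∣ ∏ q ∈ s, q ^ mExponent n q := by
    intro s hs h
    obtain ⟨q, hq, hd⟩ := (hp.prime.dvd_finsetProd_iff _).1 h
    exact (hs q hq).2 ((Nat.prime_dvd_prime_iff_eq hp (hs q hq).1).1 (hp.dvd_of_dvd_pow hd)).symm
  by_cases hmem : p ∈ (Finset.Icc 1 (n + 1)).filter Nat.Prime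
  · refine ⟨_, key (((Finset.Icc 1 (n + 1)).filter Nat.Prime).erase p) ?_,
      (Finset.mul_prod_erase _ _ hmem).symm⟩
    intro q hq
    rw [Finset.mem_erase, Finset.mem_filter] at hq
    exact ⟨hq.2.2, hq.1⟩
  · refine ⟨commonDenom n, key _ fun q hq => ⟨(Finset.mem_filter.1 hq).2, ?_⟩, ?_⟩
    · rintro rfl
      exact hmem hq
    · have h1 : n + 1 < p := by
        by_contra h
        exact hmem (Finset.mem_filter.2 ⟨Finset.mem_Icc.2 ⟨hp.one_le, by omega⟩, hp⟩)
      have h2 : n / (p - 1) = 0 := Nat.div_eq_of_lt (by omega)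
      rw [mExponent_eq hp, h2]
      simp

/-- With a = ⌊(n+1)/p⌋, the valuation of (n+1)! is a + v_p(a!), and a ≤ ⌊n/(p-1)⌋. -/
theorem factorial_dvd_commonDenom (n : ℕ) : (n + 1).factorial ∣ commonDenom n := by
  have hsupp : (n + 1).factorial.factorization.support ⊆
      (Finset.Icc 1 (n + 1)).filter Nat.Prime := by
    intro p hp
    rw [Nat.support_factorization, Nat.mem_primeFactors] at hp
    exact Finset.mem_filter.2 ⟨Finset.mem_Icc.2 ⟨hp.1.one_le, (hp.1.dvd_factorial).1 hp.2.1⟩, hp.1⟩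
  conv_lhs => rw [← Nat.prod_factorization_pow_eq_self (Nat.factorial_ne_zero (n + 1))]
  rw [Finsupp.prod_of_support_subset _ hsupp _ (fun _ _ => pow_zero _)]
  refine Finset.prod_dvd_prod_of_dvd _ _ fun p hp => pow_dvd_pow _ ?_
  obtain ⟨hp1, hp⟩ := Finset.mem_filter.1 hp
  have := Fact.mk hp
  have hle : (n + 1) / p ≤ n / (p - 1) := by
    rw [Nat.le_div_iff_mul_le (Nat.sub_pos_of_lt hp.one_lt), Nat.mul_sub_one]
    have h1 := Nat.div_mul_le_self (n + 1) p
    rcases Nat.eq_zero_or_pos ((n + 1) / p) with h | h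
    · simp [h]
    · omega
  rw [Nat.factorization_def _ hp, ← padicValNat_mul_div_factorial, padicValNat_factorial_mul,
    mExponent_eq hp, add_comm]
  exact add_le_add hle (padicValNat_factorial_mono p hle)

/-- No new prime appears, since 2l + 2 is composite. The exponent of 2 grows by one; for odd p the
even number p - 1 does not divide 2l + 1, so the floor is unchanged. -/
theorem commonDenom_two_mul_add_one {l : ℕ} (hl : 1 ≤ l) :
    commonDenom (2 * l + 1) = 2 * commonDenom (2 * l) := by
  have hset : (Finset.Icc 1 (2 * l + 1 + 1)).filter Nat.Prime =
      (Finset.Icc 1 (2 * l + 1)).filter Nat.Prime := by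
    ext p
    simp only [Finset.mem_filter, Finset.mem_Icc]
    refine ⟨fun ⟨h, hp⟩ => ⟨⟨h.1, ?_⟩, hp⟩, fun ⟨h, hp⟩ => ⟨⟨h.1, by omega⟩, hp⟩⟩
    by_contra hlt
    obtain rfl : p = 2 * (l + 1) := by omega
    exact Nat.not_prime_mul (by omega) (by omega) hp
  have h2 : 2 ∈ (Finset.Icc 1 (2 * l + 1)).filter Nat.Prime :=
    Finset.mem_filter.2 ⟨Finset.mem_Icc.2 ⟨by omega, by omega⟩, Nat.prime_two⟩
  rw [commonDenom, commonDenom, hset, ← Finset.mul_prod_erase _ _ h2, ← Finset.mul_prod_erase _ _ h2,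
    ← mul_assoc, ← pow_succ']
  congr 1
  · congr 1
    rw [mExponent_eq Nat.prime_two, mExponent_eq Nat.prime_two]
    norm_num
    rw [Nat.factorial_succ, padicValNat.mul (by omega) (Nat.factorial_ne_zero _),
      padicValNat.eq_zero_of_not_dvd (show ¬ 2 ∣ 2 * l + 1 by omega)]
    ring
  · refine Finset.prod_congr rfl fun p hp => ?_
    rw [Finset.mem_erase, Finset.mem_filter] at hp
    have hodd := hp.2.2.eq_two_or_odd.resolve_left hp.1
    rw [mExponent_eq hp.2.2, mExponent_eq hp.2.2, Nat.succ_div, if_neg, add_zero]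
    intro h
    have : 2 ∣ 2 * l + 1 := (show 2 ∣ p - 1 by omega).trans h
    omega

/-! ### Primitive integral polynomials -/

/-- Falling factorials are monic of successive degrees, so the top coefficient can be peeled off
repeatedly. -/
theorem dvd_of_C_dvd_sum_descPochhammer (a : ℤ) (c : ℕ → ℤ) (n : ℕ)
    (h : C a ∣ ∑ j ∈ Finset.range n, C (c j) * descPochhammer ℤ j) :
    ∀ j < n, a ∣ c j := by
  induction n with
  | zero => intro j hj; omega
  | succ n ih =>
    have hn : a ∣ c n := by
      have h1 := (C_dvd_iff_dvd_coeff _ _).1 h n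
      rw [Finset.sum_range_succ, coeff_add, finsetSum_coeff, Finset.sum_eq_zero, zero_add,
        coeff_C_mul] at h1
      · have h2 := stirlingS_self n
        rw [stirlingS] at h2
        rwa [h2, mul_one] at h1
      · intro j hj
        rw [coeff_C_mul, coeff_eq_zero_of_natDegree_lt, mul_zero]
        rw [descPochhammer_natDegree]
        exact Finset.mem_range.1 hj
    rw [Finset.sum_range_succ, dvd_add_left ((_root_.map_dvd C hn).mul_right _)] at h
    intro j hj
    rcases Nat.lt_succ_iff_lt_or_eq.1 hj with h1 | rfl
    exacts [ih h j h1, hn]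

/-- Multiplying by `commonDenom n` clears the denominators of `powCoeff logSeries n`, and leaves no
common factor. -/
theorem exists_isPrimitive_map_eq_powCoeff_logSeries (n : ℕ) :
    ∃ R : ℤ[X], R.IsPrimitive ∧
      R.map (Int.castRingHom ℚ) = C (commonDenom n : ℚ) * powCoeff logSeries n := by
  have hint : ∀ j, ∃ z : ℤ, (z : ℚ) = commonDenom n *
      (PowerSeries.coeff n ((logSeries - 1) ^ j) / (j.factorial : ℚ)) := by
    intro j
    refine exists_intCast_eq_of_forall_mem_pIntegral fun p hp => ?_
    obtain ⟨u, -, hu⟩ := exists_commonDenom_eq hp n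
    have h := mul_mem (natCast_mem (pIntegral p hp) u)
      (pow_mul_coeff_logSeries_sub_one_pow_mem hp n j)
    rw [hu, mExponent_eq hp]
    convert h using 1
    push_cast
    ring
  choose c hc using hint
  refine ⟨∑ j ∈ Finset.range (n + 1), C (c j) * descPochhammer ℤ j, ?_, ?_⟩
  · intro a ha
    by_contra hunit
    obtain ⟨p, hp, hpa⟩ := Nat.exists_prime_and_dvd (mt Int.isUnit_iff_natAbs_eq.2 hunit)
    have hpa' : (p : ℤ) ∣ a := Int.natCast_dvd.2 hpa
    have hj : n / (p - 1) + n % (p - 1) < n + 1 := by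
      have h1 := Nat.div_add_mod n (p - 1)
      have h2 := Nat.le_mul_of_pos_left (n / (p - 1)) (Nat.sub_pos_of_lt hp.one_lt)
      omega
    -- A prime dividing the content would divide the coefficient at the index where the bound is
    -- attained.
    obtain ⟨z, hz⟩ := hpa'.trans (dvd_of_C_dvd_sum_descPochhammer a c _ ha _ hj)
    have h1 := hc (n / (p - 1) + n % (p - 1))
    obtain ⟨u, hpu, hu⟩ := exists_commonDenom_eq hp n
    apply pow_mul_coeff_logSeries_sub_one_pow_div_notMem hp n
    have h2 := mul_mem (intCast_mem (pIntegral p hp) z) (one_div_natCast_mem_pIntegral hp hpu)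
    convert h2 using 1
    have hp0 : (p : ℚ) ≠ 0 := by exact_mod_cast hp.ne_zero
    have hu0 : (u : ℚ) ≠ 0 := by
      intro h
      apply hpu
      rw [Nat.cast_eq_zero.1 h]
      exact dvd_zero p
    rw [hz, hu, mExponent_eq hp] at h1
    push_cast at h1
    rw [mul_one_div, div_eq_div_iff hp0 hu0]
    linear_combination -h1
  · rw [Polynomial.map_sum, powCoeff, Finset.mul_sum]
    refine Finset.sum_congr rfl fun j _ => ?_
    rw [Polynomial.map_mul, map_C, descPochhammer_map, ← mul_assoc, ← C_mul, ← hc j]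
    rfl

theorem exists_isPrimitive_X_mul_map_eq {k : ℕ} (hk : k ≠ 0) :
    ∃ P : ℤ[X], P.IsPrimitive ∧
      X * P.map (Int.castRingHom ℚ) = C (commonDenom k : ℚ) * powCoeff toddSeries k := by
  obtain ⟨R, hR, hRmap⟩ := exists_isPrimitive_map_eq_powCoeff_logSeries k
  have hX : X ∣ R := by
    rw [X_dvd_iff]
    have h1 : X ∣ R.map (Int.castRingHom ℚ) := by
      rw [hRmap]
      exact (X_dvd_powCoeff constantCoeff_logSeries hk).mul_left _
    rw [X_dvd_iff, coeff_map, eq_intCast] at h1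
    exact_mod_cast h1
  obtain ⟨S, rfl⟩ := hX
  have hS : S.IsPrimitive := isPrimitive_of_dvd hR (dvd_mul_left _ _)
  refine ⟨S.comp (X - C (k : ℤ)), ?_, ?_⟩
  -- Translation is invertible over ℤ, so it preserves primitivity.
  · intro a ha
    apply hS a
    obtain ⟨T, hT⟩ := ha
    refine ⟨T.comp (X + C (k : ℤ)), ?_⟩
    have := congrArg (fun F => F.comp (X + C (k : ℤ))) hT
    simpa [comp_assoc] using this
  · apply mul_left_cancel₀ (X_sub_C_ne_zero (k : ℚ))
    have h1 := X_sub_mul_powCoeff_toddSeries k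
    have h2 := congrArg (fun F => F.comp (X - C (k : ℚ))) hRmap
    simp only [Polynomial.map_mul, map_X, mul_comp, X_comp, C_comp] at h2
    have h3 : (S.comp (X - C (k : ℤ))).map (Int.castRingHom ℚ) =
        (S.map (Int.castRingHom ℚ)).comp (X - C (k : ℚ)) := by
      rw [Polynomial.map_comp, Polynomial.map_sub, map_X, map_C]
      simp
    rw [h3]
    linear_combination X * h2 - C (commonDenom k : ℚ) * h1

theorem stirlingS_eq_of_X_mul_map_eq {k : ℕ} (hk : k ≠ 0) {P : ℤ[X]}
    (hP : X * P.map (Int.castRingHom ℚ) = C (commonDenom k : ℚ) * powCoeff toddSeries k)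
    {n : ℕ} (hn : k ≤ n) :
    (stirlingS n (n - k) : ℚ) =
      1 / mSeq k * (n.choose (k + 1) : ℚ) * ((P.eval (n : ℤ) : ℤ) : ℚ) := by
  obtain ⟨m, rfl⟩ : ∃ m, n = m + 1 := ⟨n - 1, by omega⟩
  have h1 := congrArg (Polynomial.eval ((m + 1 : ℕ) : ℚ)) hP
  have h2 := descFactorial_mul_coeff_toddSeries_pow m k hn
  rw [← eval_powCoeff constantCoeff_toddSeries] at h2
  have h3 : (P.map (Int.castRingHom ℚ)).eval ((m + 1 : ℕ) : ℚ) =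
      ((P.eval ((m + 1 : ℕ) : ℤ) : ℤ) : ℚ) := by
    rw [← Int.cast_natCast, eval_intCast_map, eq_intCast, Int.cast_id]
  rw [eval_mul, eval_mul, eval_X, eval_C, h3] at h1
  have h4 : (((m + 1) * m.descFactorial k : ℕ) : ℚ) =
      (((k + 1).factorial * (m + 1).choose (k + 1) : ℕ) : ℚ) := by
    rw [← Nat.succ_descFactorial_succ, Nat.descFactorial_eq_factorial_mul_choose]
  rw [Nat.cast_mul, Nat.cast_mul] at h4
  have hD : (commonDenom k : ℚ) ≠ 0 := by exact_mod_cast (commonDenom_pos k).ne'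
  rw [← h2, mSeq_eq, one_div_div, div_mul_eq_mul_div, div_mul_eq_mul_div, eq_div_iff hD]
  linear_combination -(m.descFactorial k : ℚ) * h1 + ((P.eval ((m + 1 : ℕ) : ℤ) : ℤ) : ℚ) * h4

theorem exists_eq_X_mul_X_sub_one_mul {l : ℕ} (hl : 1 ≤ l) {P S : ℤ[X]}
    (hP : X * P.map (Int.castRingHom ℚ) =
      C (commonDenom (2 * l) : ℚ) * powCoeff toddSeries (2 * l))
    (hS : X * S.map (Int.castRingHom ℚ) =
      C (commonDenom (2 * l + 1) : ℚ) * powCoeff toddSeries (2 * l + 1)) :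
    ∃ Q : ℤ[X], S = X * ((X - C 1) * Q) ∧ P.eval 0 = Q.eval 0 := by
  obtain ⟨T, hT⟩ := X_pow_three_dvd_powCoeff_toddSeries l hl
  have hmap : S.map (Int.castRingHom ℚ) =
      X * (X * (C (commonDenom (2 * l) : ℚ) * T) - P.map (Int.castRingHom ℚ)) := by
    apply mul_left_cancel₀ (X_ne_zero (R := ℚ))
    rw [commonDenom_two_mul_add_one hl] at hS
    push_cast [map_mul] at hS
    rw [show (C (2 : ℚ) : ℚ[X]) = 2 from rfl] at hS
    linear_combination hS + C (commonDenom (2 * l) : ℚ) * hT + X * hP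
  have hX : X ∣ S := by
    rw [X_dvd_iff]
    have h1 : X ∣ S.map (Int.castRingHom ℚ) := ⟨_, hmap⟩
    rw [X_dvd_iff, coeff_map, eq_intCast] at h1
    exact_mod_cast h1
  obtain ⟨U, rfl⟩ := hX
  rw [Polynomial.map_mul, map_X] at hmap hS
  -- Now U ≡ -P mod X over ℚ; the factor X - 1 has value -1 at 0 and absorbs this sign.
  have hU := mul_left_cancel₀ X_ne_zero hmap
  have h1 : X - C 1 ∣ U := by
    rw [dvd_iff_isRoot, IsRoot]
    have h2 := congrArg (Polynomial.eval (1 : ℚ)) hS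
    rw [eval_mul, eval_mul, eval_mul, eval_one_powCoeff_toddSeries ⟨l, rfl⟩ (by omega), eval_X,
      one_mul, one_mul, mul_zero, eval_one_map, eq_intCast] at h2
    exact_mod_cast h2
  obtain ⟨Q, rfl⟩ := h1
  refine ⟨Q, rfl, ?_⟩
  have h3 := congrArg (Polynomial.eval (0 : ℚ)) hU
  rw [eval_sub, eval_mul, eval_X, zero_mul, zero_sub, eval_zero_map, eval_zero_map, ← map_neg] at h3
  have h4 := (Int.cast_injective (α := ℚ)) h3
  simp at h4
  exact h4.symm

theorem mainTheorem1 :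
    (∀ n : ℕ, ∃ a : ℕ, mSeq n = (a : ℚ)) ∧
    ∀ k : ℕ, 1 ≤ k →
      ∃ P Q : ℤ[X], P.IsPrimitive ∧ Q.IsPrimitive ∧
        (∀ n : ℕ, 2 * k ≤ n →
          (stirlingS n (n - 2 * k) : ℚ) =
            1 / mSeq (2 * k) * (Nat.choose n (2 * k + 1) : ℚ) * ((P.eval (n : ℤ) : ℤ) : ℚ)) ∧
        (∀ n : ℕ, 2 * k + 1 ≤ n →
          (stirlingS n (n - 2 * k - 1) : ℚ) =
            1 / mSeq (2 * k + 1) * (Nat.choose n (2 * k + 2) : ℚ) *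
              ((n : ℚ) * ((n : ℚ) - 1)) * ((Q.eval (n : ℤ) : ℤ) : ℚ)) ∧
        P.eval 0 = Q.eval 0 := by
  refine ⟨fun n => ?_, fun k hk => ?_⟩
  · obtain ⟨a, ha⟩ := factorial_dvd_commonDenom n
    refine ⟨a, ?_⟩
    have h : ((n + 1).factorial : ℚ) ≠ 0 := by positivity
    rw [mSeq_eq, ha, Nat.cast_mul, mul_div_cancel_left₀ _ h]
  · obtain ⟨P, hPprim, hP⟩ := exists_isPrimitive_X_mul_map_eq (k := 2 * k) (by omega)
    obtain ⟨S, hSprim, hS⟩ := exists_isPrimitive_X_mul_map_eq (k := 2 * k + 1) (by omega)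
    obtain ⟨Q, rfl, hPQ⟩ := exists_eq_X_mul_X_sub_one_mul hk hP hS
    refine ⟨P, Q, hPprim,
      isPrimitive_of_dvd hSprim ((dvd_mul_left _ _).trans (dvd_mul_left _ _)),
      fun n hn => stirlingS_eq_of_X_mul_map_eq (by omega) hP hn, fun n hn => ?_, hPQ⟩
    rw [Nat.sub_sub, stirlingS_eq_of_X_mul_map_eq (by omega) hS hn]
    simp only [eval_mul, eval_sub, eval_X, eval_C]
    push_cast
    ring
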